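/- There is an algorithm that, given as input any finite collection $F$ of nonsingular matrices from $\mathbb{Z}^{2\times 2}$ (that is, $\det A\neq 0$ for every $A\in F$) and any matrix $M\in\mathbb{Z}^{2\times 2}$, decides whether $M\in\langle F\rangle$. Here $\langle F\rangle$ denotes the semigroup generated by $F$, including the identity matrix: $M\in\langle F\rangle$ if and only if $M=I$ or there are $k\ge 1$ and matrices $M_1,\dots,M_k\in F$ with $M=M_1M_2\cdots M_k$. -/

import Mathlib

/-- A `2 × 2` integer matrix is presented to an algorithm by its four entries: matrices are encoded
by the standard encoding of the functions `Fin 2 → Fin 2 → ℤ`. -/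
instance Mat2.primcodable : Primcodable (Matrix (Fin 2) (Fin 2) ℤ) :=
  Primcodable.ofEquiv (Fin 2 → Fin 2 → ℤ) Matrix.of.symm

/-!
Membership and non-membership in the monoid generated by `F` are both recursively enumerable, so
membership is decidable by Post's theorem. Membership is witnessed by a list of factors; what needs
an argument is that non-membership of a nonsingular matrix `M` has finite, checkable certificates.

Sanov's group `Γ`, generated by `!![1, 2; 0, 1]` and `!![1, 0; 2, 1]`, acts by left multiplication
on the nonsingular integer matrices. It is free (`Sanov.hom_injective`) and is defined in `SL(2, ℤ)`
by congruences modulo `4` (`Sanov.exists_hom_eq`), so that two matrices with the same determinant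
`d` which agree modulo `4 * d` lie in the same orbit. Hence there are only finitely many orbits of
matrices whose determinant is at most that of `M` in absolute value
(`Sanov.exists_orbit_representatives`). All partial products of a factorisation of `M` lie in these
orbits, so a factorisation is a walk
`hom u₀ * h₀, hom u₁ * h₁, …` with the `hᵢ` taken from a finite list of representatives. By
invariance under `Γ`, whether a walk leads from `hom u * h` to `hom v * h'` depends only on
`h`, `h'` and `u⁻¹ * v`.

The word metric of a free group satisfies the four-point condition (`FreeGroup.four_point`). It
follows that the relation "a walk leads from one point to the other", restricted to points at
distance at most `r`, is generated by single steps under composition of two steps whose composite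
again has length at most `r`, as soon as `r` bounds the length of the single steps
(`rel_of_reflTransGen_of_dist_le`). Therefore any finite set of triples
`(h, U, h')` that contains the single steps and is closed under such short composition contains
every true triple of length at most `r`. If such a set omits the triples that represent `M`, this
proves that `M` is not a product (`IsCertificate.not_mem_closure`); conversely the set of all true
triples is such a set (`exists_isCertificate`).
-/

/-! ### Short chains in a tree-like metric -/

section TreeMetric

variable {P : Type*} (d : P → P → ℕ) (K : P → P → Prop) (r : ℕ)

/-- `IsTautChain d K r x w y` says that some chain of `K`-steps leads from `x` to `y`, has
`w ⟶ y` as its last step, and contains no two consecutive steps of combined length at most `r`. -/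
inductive IsTautChain (x : P) : P → P → Prop
  | single {y : P} : K x y → IsTautChain x x y
  | step {w y z : P} : IsTautChain x w y → K y z → r < d w z → IsTautChain x y z

variable {d K r}

theorem IsTautChain.rel {x w y : P} (h : IsTautChain d K r x w y) : K w y := by
  cases h <;> assumption

/-- In a taut chain the distance to the starting point never decreases. This is where the
four-point condition enters. -/
theorem IsTautChain.dist_mono
    (h4 : ∀ x w y z, d w z + d x y ≤ max (d x w + d y z) (d x z + d w y))
    (hself : ∀ x, d x x = 0) (hK : ∀ x y, K x y → d x y ≤ r)
    {x w y : P} (h : IsTautChain d K r x w y) :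
    d x w ≤ d x y ∧ (w = x ∨ r < d x y) := by
  induction h with
  | single h => simp [hself]
  | @step w y z hc hyz hr ih =>
    have h1 := h4 x w y z
    have h2 := hK _ _ hyz
    have h3 := hK _ _ hc.rel
    rcases le_max_iff.1 h1 with h5 | h5
    · omega
    · refine ⟨by omega, Or.inr ?_⟩
      rcases ih.2 with rfl | h6 <;> omega

theorem IsTautChain.extend
    (hcomp : ∀ x y z, K x y → K y z → d x z ≤ r → K x z)
    {x w y : P} (h : IsTautChain d K r x w y) :
    ∀ {z : P}, K y z → ∃ w', IsTautChain d K r x w' z := by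
  induction h with
  | @single y h =>
    intro z hz
    by_cases hd : d x z ≤ r
    · exact ⟨x, .single (hcomp _ _ _ h hz hd)⟩
    · exact ⟨y, .step (.single h) hz (by omega)⟩
  | @step w y y' hc hK hr ih =>
    intro z hz
    by_cases hd : d y z ≤ r
    · exact ih (hcomp _ _ _ hK hz hd)
    · exact ⟨y', .step (.step hc hK hr) hz (by omega)⟩

/-- Let `d` satisfy the four-point condition, and let `K` be a reflexive relation between points at
distance at most `r` which contains the composite of two of its steps whenever that composite has
length at most `r`. Then every chain of `K`-steps between points at distance at most `r` is
a single `K`-step. -/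
theorem rel_of_reflTransGen_of_dist_le
    (h4 : ∀ x w y z, d w z + d x y ≤ max (d x w + d y z) (d x z + d w y))
    (hself : ∀ x, d x x = 0) (hK : ∀ x y, K x y → d x y ≤ r)
    (hcomp : ∀ x y z, K x y → K y z → d x z ≤ r → K x z)
    {x y : P} (hx : K x x) (hxy : Relation.ReflTransGen K x y) (hd : d x y ≤ r) : K x y := by
  have : ∃ w, IsTautChain d K r x w y := by
    clear hd
    induction hxy with
    | refl => exact ⟨x, .single hx⟩
    | tail _ hbc ih =>
      obtain ⟨w, hw⟩ := ih
      exact hw.extend hcomp hbc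
  obtain ⟨w, hw⟩ := this
  rcases (hw.dist_mono h4 hself hK).2 with rfl | h
  · exact hw.rel
  · omega

end TreeMetric

/-! ### The four-point condition for the word metric of a free group -/

section FreeGroupMetric

variable {α : Type*} [DecidableEq α]

/-- The length of the longest common prefix of two lists. -/
def List.lcpLength {β : Type*} [DecidableEq β] : List β → List β → ℕ
  | a :: l, b :: l' => if a = b then lcpLength l l' + 1 else 0
  | _, _ => 0

theorem List.min_lcpLength_le {β : Type*} [DecidableEq β] (l₁ l₂ l₃ : List β) :
    min (l₁.lcpLength l₂) (l₂.lcpLength l₃) ≤ l₁.lcpLength l₃ := by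
  induction l₁ generalizing l₂ l₃ with
  | nil => simp [lcpLength]
  | cons a l₁ ih =>
    rcases l₂ with _ | ⟨b, l₂⟩
    · simp [lcpLength]
    rcases l₃ with _ | ⟨c, l₃⟩
    · simp [lcpLength]
    have := ih l₂ l₃
    by_cases h1 : a = b <;> by_cases h2 : b = c
    · subst h1 h2
      simp only [lcpLength, if_true]
      omega
    all_goals grind [lcpLength]

theorem List.lcpLength_comm {β : Type*} [DecidableEq β] (l₁ l₂ : List β) :
    l₁.lcpLength l₂ = l₂.lcpLength l₁ := by
  induction l₁ generalizing l₂ with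
  | nil => rcases l₂ with _ | ⟨b, l₂⟩ <;> simp [lcpLength]
  | cons a l₁ ih =>
    rcases l₂ with _ | ⟨b, l₂⟩
    · simp [lcpLength]
    simp only [lcpLength, eq_comm, ih l₂]

namespace FreeGroup

theorem norm_mk_of_isReduced {L : List (α × Bool)} (h : IsReduced L) :
    norm (mk L) = L.length := by
  rw [norm, toWord_mk, h.reduce_eq]

/-- Multiplying `g⁻¹` by `h` cancels exactly the common prefix of the two reduced words. -/
theorem norm_inv_mul_mk {L L' : List (α × Bool)} (h : IsReduced L) (h' : IsReduced L') :
    norm ((mk L)⁻¹ * mk L') + 2 * L.lcpLength L' = L.length + L'.length := by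
  induction L generalizing L' with
  | nil =>
    rw [← one_eq_mk, inv_one, one_mul, norm_mk_of_isReduced h']
    simp [List.lcpLength]
  | cons a L ih =>
    rcases L' with _ | ⟨b, L'⟩
    · rw [← one_eq_mk, mul_one, norm_inv_eq, norm_mk_of_isReduced h]
      simp [List.lcpLength]
    by_cases hab : a = b
    · subst hab
      have e : (mk (a :: L))⁻¹ * mk (a :: L') = (mk L)⁻¹ * mk L' := by
        have e1 : ∀ l, mk (a :: l) = mk [a] * mk l := fun l => by simp [mul_mk]
        rw [e1 L, e1 L']
        group
      rw [e]
      have := ih (h.infix (List.infix_cons List.infix_rfl))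
        (h'.infix (List.infix_cons List.infix_rfl))
      simp only [List.lcpLength, if_true, List.length_cons]
      omega
    · have hred : IsReduced (invRev (a :: L) ++ b :: L') := by
        have h1 : IsReduced (invRev (a :: L)) := by
          rw [isReduced_iff_reduce_eq, reduce_invRev, h.reduce_eq]
        refine List.isChain_append.2 ⟨h1, h', ?_⟩
        intro x hx y hy
        simp only [invRev, List.map_cons, List.reverse_cons, List.getLast?_append,
          List.getLast?_singleton, Option.some_or, Option.mem_def, Option.some.injEq] at hx
        simp only [List.head?_cons, Option.mem_def, Option.some.injEq] at hy
        subst hx hy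
        intro hfst
        have : a.2 ≠ b.2 := fun h2 => hab (Prod.ext hfst h2)
        revert this
        cases a.2 <;> cases b.2 <;> simp
      rw [inv_mk, mul_mk, norm_mk_of_isReduced hred]
      simp [List.lcpLength, hab]

theorem norm_inv_mul (g h : FreeGroup α) :
    norm (g⁻¹ * h) + 2 * g.toWord.lcpLength h.toWord = norm g + norm h := by
  have := norm_inv_mul_mk (isReduced_toWord (x := g)) (isReduced_toWord (x := h))
  simpa [mk_toWord, norm] using this

/-- The Cayley graph of a free group is a tree, so its word metric satisfies the four-point
condition. -/
theorem four_point (x w y z : FreeGroup α) :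
    norm (w⁻¹ * z) + norm (x⁻¹ * y) ≤
      max (norm (x⁻¹ * w) + norm (y⁻¹ * z)) (norm (x⁻¹ * z) + norm (w⁻¹ * y)) := by
  -- By left invariance, `y` may be taken as the base point.
  have key : ∀ x w z : FreeGroup α, norm (w⁻¹ * z) + norm x ≤
      max (norm (x⁻¹ * w) + norm z) (norm (x⁻¹ * z) + norm w) := by
    intro x w z
    have h1 := norm_inv_mul w z
    have h2 := norm_inv_mul x w
    have h3 := norm_inv_mul x z
    have h4 := List.min_lcpLength_le w.toWord x.toWord z.toWord
    rw [List.lcpLength_comm w.toWord x.toWord] at h4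
    omega
  have h := key (y⁻¹ * x) (y⁻¹ * w) (y⁻¹ * z)
  have e1 : norm (y⁻¹ * x) = norm (x⁻¹ * y) := by
    rw [← norm_inv_eq (x := y⁻¹ * x)]; simp
  have e2 : norm (y⁻¹ * w) = norm (w⁻¹ * y) := by
    rw [← norm_inv_eq (x := y⁻¹ * w)]; simp
  have e : ∀ a b : FreeGroup α, (y⁻¹ * a)⁻¹ * (y⁻¹ * b) = a⁻¹ * b := fun a b => by group
  simpa only [e, e1, e2] using h

end FreeGroup

end FreeGroupMetric

/-! ### A free subgroup of `SL(2, ℤ)` -/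

open Matrix

/-- The sum of the squares of the entries of a `2 × 2` integer matrix. -/
def sqSum (U : Matrix (Fin 2) (Fin 2) ℤ) : ℤ :=
  U 0 0 * U 0 0 + U 0 1 * U 0 1 + (U 1 0 * U 1 0 + U 1 1 * U 1 1)

namespace Sanov

/-- The free generators `!![1, 2; 0, 1]` (at `true`) and `!![1, 0; 2, 1]` (at `false`) of Sanov's
subgroup of `SL(2, ℤ)`. -/
def gen : Bool → (Matrix (Fin 2) (Fin 2) ℤ)ˣ
  | true => ⟨!![1, 2; 0, 1], !![1, -2; 0, 1], by simp [one_fin_two], by simp [one_fin_two]⟩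
  | false => ⟨!![1, 0; 2, 1], !![1, 0; -2, 1], by simp [one_fin_two], by simp [one_fin_two]⟩

/-- The homomorphism from the free group of rank two onto Sanov's subgroup of `SL(2, ℤ)`, with
values taken in the monoid of all integer matrices. -/
def hom : FreeGroup Bool →* Matrix (Fin 2) (Fin 2) ℤ :=
  (Units.coeHom _).comp (FreeGroup.lift gen)

/-- The exponent `±1` that a Boolean stands for in a letter of a free group. -/
def sgn (ε : Bool) : ℤ := if ε then 1 else -1

/-- The matrix of the letter `(g, ε)`. -/
def letter (x : Bool × Bool) : Matrix (Fin 2) (Fin 2) ℤ :=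
  if x.1 then !![1, 2 * sgn x.2; 0, 1] else !![1, 0; 2 * sgn x.2, 1]

theorem hom_mk_cons (x : Bool × Bool) (L : List (Bool × Bool)) :
    hom (FreeGroup.mk (x :: L)) = letter x * hom (FreeGroup.mk L) := by
  have e : FreeGroup.mk (x :: L) = FreeGroup.mk [x] * FreeGroup.mk L := by
    simp [FreeGroup.mul_mk]
  rw [e, map_mul]
  congr 1
  obtain ⟨g, ε⟩ := x
  cases g <;> cases ε <;> simp [hom, gen, letter, sgn]

theorem letter_true_mul (ε : Bool) (V : Matrix (Fin 2) (Fin 2) ℤ) :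
    letter (true, ε) * V =
      !![V 0 0 + 2 * sgn ε * V 1 0, V 0 1 + 2 * sgn ε * V 1 1; V 1 0, V 1 1] := by
  nth_rewrite 1 [eta_fin_two V]
  simp [letter]

theorem letter_false_mul (ε : Bool) (V : Matrix (Fin 2) (Fin 2) ℤ) :
    letter (false, ε) * V =
      !![V 0 0, V 0 1; 2 * sgn ε * V 0 0 + V 1 0, 2 * sgn ε * V 0 1 + V 1 1] := by
  nth_rewrite 1 [eta_fin_two V]
  simp [letter]

theorem det_hom (w : FreeGroup Bool) : (hom w).det = 1 := by
  rw [← FreeGroup.mk_toWord (x := w)]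
  induction w.toWord with
  | nil => rw [← FreeGroup.one_eq_mk, map_one, det_one]
  | cons x L ih =>
    rw [hom_mk_cons, det_mul, ih, letter]
    split_ifs <;> simp

/-- Here `R`, `S` and `p` stand for `u ⬝ u`, `v ⬝ v` and `u ⬝ v`, where `u` and `v` are the rows of
a matrix of determinant one. If the last change was made to the row `v` (so that `R ≤ ± p`), then
adding `± 2 v` to the row `u`, with either sign, makes it longer. -/
theorem neg_lt_of_lagrange {R S p : ℤ} (hR : 0 < R) (hlag : R * S = p * p + 1) {s t : ℤ}
    (hs : s = 1 ∨ s = -1) (ht : t = 1 ∨ t = -1) (h : R ≤ t * p) : 0 < s * p + S := by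
  have : |p| < S := by
    by_contra! hlt
    have h1 : R ≤ |p| := by
      rcases ht with rfl | rfl
      · exact h.trans (by simpa using le_abs_self p)
      · exact h.trans (by simpa using neg_le_abs p)
    nlinarith [abs_mul_abs_self p]
  have := neg_abs_le p
  have := le_abs_self p
  rcases hs with rfl | rfl <;> omega

theorem sgn_eq (ε : Bool) : sgn ε = 1 ∨ sgn ε = -1 := by cases ε <;> simp [sgn]

/-- A reduced word of length `n` maps to a matrix `U` with `sqSum U ≥ 4 n + 2`. In terms of the rows
`u`, `v` of `U`, the induction uses that a word whose first letter adds `± 2 v` to `u` yields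
`± u ⬝ v ≥ v ⬝ v`, and symmetrically. -/
theorem growth (L : List (Bool × Bool)) (hL : FreeGroup.IsReduced L)
    (U : Matrix (Fin 2) (Fin 2) ℤ) (hU : U = hom (FreeGroup.mk L)) :
    4 * (L.length : ℤ) + 2 ≤ sqSum U ∧
    (∀ ε, L.head? = some (true, ε) →
      U 1 0 * U 1 0 + U 1 1 * U 1 1 ≤ sgn ε * (U 0 0 * U 1 0 + U 0 1 * U 1 1)) ∧
    (∀ ε, L.head? = some (false, ε) →
      U 0 0 * U 0 0 + U 0 1 * U 0 1 ≤ sgn ε * (U 0 0 * U 1 0 + U 0 1 * U 1 1)) := by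
  induction L generalizing U with
  | nil =>
    have : U = 1 := by rw [hU, ← FreeGroup.one_eq_mk, map_one]
    subst this
    simp [sqSum]
  | cons x L ih =>
    obtain ⟨ih1, ih2, ih3⟩ := ih (hL.infix (List.infix_cons List.infix_rfl)) _ rfl
    have hdet := det_hom (FreeGroup.mk L)
    have hnil : L = [] → hom (FreeGroup.mk L) = 1 := by
      rintro rfl
      rw [← FreeGroup.one_eq_mk, map_one]
    rw [hom_mk_cons] at hU
    generalize hom (FreeGroup.mk L) = V at *
    rw [det_fin_two] at hdet
    simp only [sqSum] at ih1
    obtain ⟨R, hR⟩ : ∃ R, R = V 0 0 * V 0 0 + V 0 1 * V 0 1 := ⟨_, rfl⟩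
    obtain ⟨S, hS⟩ : ∃ S, S = V 1 0 * V 1 0 + V 1 1 * V 1 1 := ⟨_, rfl⟩
    obtain ⟨p, hp⟩ : ∃ p, p = V 0 0 * V 1 0 + V 0 1 * V 1 1 := ⟨_, rfl⟩
    -- Lagrange's identity for the two rows of a matrix of determinant one.
    have hlag : R * S = p * p + 1 := by
      subst hR hS hp
      linear_combination (V 0 0 * V 1 1 - V 0 1 * V 1 0 + 1) * hdet
    have hR0 : 0 < R := by
      have : 0 ≤ R := by rw [hR]; exact add_nonneg (mul_self_nonneg _) (mul_self_nonneg _)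
      rcases this.eq_or_lt with h | h
      · rw [← h] at hlag; nlinarith
      · exact h
    have hS0 : 0 < S := by nlinarith
    rw [← hR, ← hS] at ih1
    rw [← hS, ← hp] at ih2
    rw [← hR, ← hp] at ih3
    have hp0 : L = [] → p = 0 := fun h => by simp [hp, hnil h]
    obtain ⟨g, ε⟩ := x
    obtain ⟨s, hs⟩ : ∃ s, s = sgn ε := ⟨_, rfl⟩
    have hs1 : s * s = 1 := by rcases sgn_eq ε with h | h <;> rw [hs, h] <;> norm_num
    have hs2 : s = 1 ∨ s = -1 := hs ▸ sgn_eq ε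
    have hhead : ∀ y, L.head? = some y → g = y.1 → ε = y.2 := by
      intro y hy
      rcases L with _ | ⟨z, L⟩
      · simp at hy
      · obtain rfl : z = y := by simpa using hy
        exact (FreeGroup.isReduced_cons_cons.1 hL).1
    cases g
    · have hkey : 0 < s * p + R := by
        rcases hh : L.head? with _ | ⟨g', ε'⟩
        · rw [hp0 (by simpa using hh)]; omega
        cases g'
        · have := ih3 _ hh
          obtain rfl : ε = ε' := hhead _ hh rfl
          rw [← hs] at this
          omega
        · exact neg_lt_of_lagrange hS0 (by linarith) hs2 (sgn_eq ε') (ih2 _ hh)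
      have e1 : U 0 0 * U 0 0 + U 0 1 * U 0 1 = R := by
        simp [hU, hR, letter_false_mul]
      have e2 : U 1 0 * U 1 0 + U 1 1 * U 1 1 = S + 4 * (s * p + R) := by
        simp [hU, hR, hS, hp, letter_false_mul, ← hs]
        linear_combination (4 * (V 0 0 * V 0 0 + V 0 1 * V 0 1)) * hs1
      have e3 : U 0 0 * U 1 0 + U 0 1 * U 1 1 = p + 2 * s * R := by
        simp [hU, hR, hp, letter_false_mul, ← hs]
        ring
      refine ⟨?_, by simp, ?_⟩
      · rw [sqSum, e1, e2, List.length_cons]; push_cast; linarith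
      · intro ε' h
        obtain rfl : ε = ε' := by simpa using h
        rw [e1, e3, ← hs]
        nlinarith
    · have hkey : 0 < s * p + S := by
        rcases hh : L.head? with _ | ⟨g', ε'⟩
        · rw [hp0 (by simpa using hh)]; omega
        cases g'
        · exact neg_lt_of_lagrange hR0 hlag hs2 (sgn_eq ε') (ih3 _ hh)
        · have := ih2 _ hh
          obtain rfl : ε = ε' := hhead _ hh rfl
          rw [← hs] at this
          omega
      have e1 : U 1 0 * U 1 0 + U 1 1 * U 1 1 = S := by
        simp [hU, hS, letter_true_mul]
      have e2 : U 0 0 * U 0 0 + U 0 1 * U 0 1 = R + 4 * (s * p + S) := by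
        simp [hU, hR, hS, hp, letter_true_mul, ← hs]
        linear_combination (4 * (V 1 0 * V 1 0 + V 1 1 * V 1 1)) * hs1
      have e3 : U 0 0 * U 1 0 + U 0 1 * U 1 1 = p + 2 * s * S := by
        simp [hU, hS, hp, letter_true_mul, ← hs]
        ring
      refine ⟨?_, ?_, by simp⟩
      · rw [sqSum, e1, e2, List.length_cons]; push_cast; linarith
      · intro ε' h
        obtain rfl : ε = ε' := by simpa using h
        rw [e1, e3, ← hs]
        nlinarith

theorem norm_le_sqSum (w : FreeGroup Bool) : 4 * (w.norm : ℤ) + 2 ≤ sqSum (hom w) :=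
  (growth w.toWord FreeGroup.isReduced_toWord _ (by rw [FreeGroup.mk_toWord])).1

theorem hom_injective : Function.Injective hom := by
  intro v w h
  have h1 : hom (v⁻¹ * w) = 1 := by rw [map_mul, ← h, ← map_mul, inv_mul_cancel, map_one]
  have h2 := norm_le_sqSum (v⁻¹ * w)
  rw [h1] at h2
  have h3 : (v⁻¹ * w).norm = 0 := by
    simp [sqSum] at h2
    omega
  rw [FreeGroup.norm_eq_zero] at h3
  exact inv_mul_eq_one.1 h3

/-- Sanov's congruence conditions characterise the image of `hom`. While the rows `u`, `v` of the
matrix satisfy `|u ⬝ v| > min (u ⬝ u) (v ⬝ v)`, one of the generators shortens a row; when they no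
longer do, the matrix is the identity. -/
theorem exists_hom_eq (U : Matrix (Fin 2) (Fin 2) ℤ) (hdet : U.det = 1)
    (h00 : U 0 0 ≡ 1 [ZMOD 4]) (h11 : U 1 1 ≡ 1 [ZMOD 4])
    (h01 : U 0 1 ≡ 0 [ZMOD 2]) (h10 : U 1 0 ≡ 0 [ZMOD 2]) : ∃ w, hom w = U := by
  obtain ⟨n, hn⟩ : ∃ n, n = (sqSum U).toNat := ⟨_, rfl⟩
  induction n using Nat.strong_induction_on generalizing U with
  | _ n ih =>
  -- It is enough to shorten `U` by left multiplication with a letter.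
  have step : ∀ (g ε : Bool), sqSum (letter (g, ε) * U) < sqSum U → ∃ w, hom w = U := by
    intro g ε hlt
    have hpos : 0 ≤ sqSum (letter (g, ε) * U) := by
      unfold sqSum
      nlinarith [mul_self_nonneg ((letter (g, ε) * U) 0 0),
        mul_self_nonneg ((letter (g, ε) * U) 0 1), mul_self_nonneg ((letter (g, ε) * U) 1 0),
        mul_self_nonneg ((letter (g, ε) * U) 1 1)]
    have key : ∃ w, hom w = letter (g, ε) * U := by
      refine ih _ ?_ (letter (g, ε) * U) ?_ ?_ ?_ ?_ ?_ rfl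
      · omega
      · rw [det_mul, hdet]; cases g <;> simp [letter]
      all_goals
        cases g <;> cases ε <;> simp [letter_true_mul, letter_false_mul, sgn] <;>
        simp only [Int.ModEq] at * <;> omega
    obtain ⟨w, hw⟩ := key
    refine ⟨FreeGroup.mk [(g, !ε)] * w, ?_⟩
    rw [map_mul, hw, hom_mk_cons, ← FreeGroup.one_eq_mk, map_one, mul_one, ← mul_assoc]
    have : letter (g, !ε) * letter (g, ε) = 1 := by
      cases g <;> cases ε <;> simp [letter, sgn, one_fin_two]
    rw [this, one_mul]
  rw [det_fin_two] at hdet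
  obtain ⟨R, hR⟩ : ∃ R, R = U 0 0 * U 0 0 + U 0 1 * U 0 1 := ⟨_, rfl⟩
  obtain ⟨S, hS⟩ : ∃ S, S = U 1 0 * U 1 0 + U 1 1 * U 1 1 := ⟨_, rfl⟩
  obtain ⟨p, hp⟩ : ∃ p, p = U 0 0 * U 1 0 + U 0 1 * U 1 1 := ⟨_, rfl⟩
  have hlag : R * S = p * p + 1 := by
    subst hR hS hp
    linear_combination (U 0 0 * U 1 1 - U 0 1 * U 1 0 + 1) * hdet
  have hR0 : 0 ≤ R := by rw [hR]; exact add_nonneg (mul_self_nonneg _) (mul_self_nonneg _)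
  have hS0 : 0 ≤ S := by rw [hS]; exact add_nonneg (mul_self_nonneg _) (mul_self_nonneg _)
  have change : ∀ (ε : Bool),
      sqSum (letter (true, ε) * U) = sqSum U + 4 * (sgn ε * p + S) ∧
      sqSum (letter (false, ε) * U) = sqSum U + 4 * (sgn ε * p + R) := by
    intro ε
    cases ε <;> simp [sqSum, letter_true_mul, letter_false_mul, sgn, hR, hS, hp] <;>
      constructor <;> ring
  by_cases h1 : S < p
  · exact step true false (by rw [(change false).1]; simp [sgn]; omega)
  by_cases h2 : S < -p
  · exact step true true (by rw [(change true).1]; simp [sgn]; omega)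
  by_cases h3 : R < p
  · exact step false false (by rw [(change false).2]; simp [sgn]; omega)
  by_cases h4 : R < -p
  · exact step false true (by rw [(change true).2]; simp [sgn]; omega)
  -- Now `|p| ≤ R, S`, and `p` is even because the off-diagonal entries are.
  have hpe : p % 2 = 0 := by
    obtain ⟨k, hk⟩ := Int.modEq_zero_iff_dvd.1 h01
    obtain ⟨l, hl⟩ := Int.modEq_zero_iff_dvd.1 h10
    rw [hp, hk, hl]
    have : U 0 0 * (2 * l) + 2 * k * U 1 1 = 2 * (U 0 0 * l + k * U 1 1) := by ring
    omega
  have hp0 : p = 0 := by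
    by_contra hne
    have hq : 2 ≤ |p| := by
      rcases abs_cases p with ⟨h, _⟩ | ⟨h, _⟩ <;> omega
    have hqR : |p| ≤ R := abs_le.2 ⟨by omega, by omega⟩
    have hqS : |p| ≤ S := abs_le.2 ⟨by omega, by omega⟩
    rw [← abs_mul_abs_self p] at hlag
    rcases hqR.eq_or_lt with h | h
    · rcases hqS.eq_or_lt with h' | h'
      · rw [← h, ← h'] at hlag; omega
      · nlinarith
    · nlinarith
  have hRS : R * S = 1 := by rw [hlag, hp0]; norm_num
  have hR1 : R = 1 := Int.eq_one_of_mul_eq_one_right hR0 hRS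
  have hS1 : S = 1 := by rw [hR1] at hRS; omega
  simp only [Int.ModEq] at h00 h11
  have b0 : U 0 1 = 0 := by
    have : U 0 0 ≠ 0 := by omega
    have : 0 < U 0 0 * U 0 0 := mul_self_pos.2 this
    have : U 0 1 * U 0 1 ≤ 0 := by linarith
    nlinarith
  have c0 : U 1 0 = 0 := by
    have : U 1 1 ≠ 0 := by omega
    have : 0 < U 1 1 * U 1 1 := mul_self_pos.2 this
    have : U 1 0 * U 1 0 ≤ 0 := by linarith
    nlinarith
  have a1 : U 0 0 = 1 := by
    have : U 0 0 * U 0 0 = 1 := by rw [b0] at hR; linarith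
    rcases mul_self_eq_one_iff.1 this with h | h <;> omega
  have d1 : U 1 1 = 1 := by
    have : U 1 1 * U 1 1 = 1 := by rw [c0] at hS; linarith
    rcases mul_self_eq_one_iff.1 this with h | h <;> omega
  refine ⟨1, ?_⟩
  rw [map_one, one_fin_two, eta_fin_two U, a1, b0, c0, d1]

end Sanov

/-! ### Primitive recursive integer and matrix arithmetic -/

section IntPrimrec

theorem primrec_intEquivNatSumNat : Primrec Equiv.intEquivNatSumNat := by
  refine Primrec.encode_iff.1 ((Primrec.encode (α := ℤ)).of_eq fun z => ?_)
  cases z <;> rfl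

theorem primrec_intEquivNatSumNat_symm : Primrec Equiv.intEquivNatSumNat.symm := by
  refine Primrec.encode_iff.1 ((Primrec.encode (α := ℕ ⊕ ℕ)).of_eq fun z => ?_)
  cases z <;> rfl

theorem primrec_int_toNat : Primrec Int.toNat := by
  refine (Primrec.sumCasesOn primrec_intEquivNatSumNat (g := fun _ n => n) (h := fun _ _ => 0)
    Primrec₂.right (Primrec₂.const 0)).of_eq fun z => ?_
  cases z <;> rfl

theorem primrec_int_neg_toNat : Primrec fun z : ℤ => (-z).toNat := by
  refine (Primrec.sumCasesOn primrec_intEquivNatSumNat (g := fun _ _ => 0)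
    (h := fun _ n => n + 1) (Primrec₂.const 0) (Primrec.succ.comp₂ Primrec₂.right)).of_eq
    fun z => ?_
  cases z with
  | ofNat n =>
    change 0 = (-(n : ℤ)).toNat
    omega
  | negSucc n => rfl

theorem primrec_nat_sub_int : Primrec₂ fun m n : ℕ => (m : ℤ) - n := by
  have h : Primrec₂ fun m n : ℕ =>
      if n ≤ m then (Sum.inl (m - n) : ℕ ⊕ ℕ) else Sum.inr (n - m).pred :=
    Primrec.ite (Primrec.nat_le.comp Primrec.snd Primrec.fst)
      (Primrec.sumInl.comp (Primrec.nat_sub.comp Primrec.fst Primrec.snd))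
      (Primrec.sumInr.comp (Primrec.pred.comp (Primrec.nat_sub.comp Primrec.snd Primrec.fst)))
  refine (primrec_intEquivNatSumNat_symm.comp₂ h).of_eq fun m n => ?_
  split_ifs with hmn
  · change ((m - n : ℕ) : ℤ) = _
    omega
  · change Int.negSucc (n - m).pred = _
    rw [Nat.pred_eq_sub_one]
    omega

variable {α : Type*} [Primcodable α] {f g : α → ℤ}

theorem Primrec.int_add (hf : Primrec f) (hg : Primrec g) : Primrec fun a => f a + g a := by
  refine (primrec_nat_sub_int.comp
    (Primrec.nat_add.comp (primrec_int_toNat.comp hf) (primrec_int_toNat.comp hg))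
    (Primrec.nat_add.comp (primrec_int_neg_toNat.comp hf)
      (primrec_int_neg_toNat.comp hg))).of_eq fun a => ?_
  omega

theorem Primrec.int_neg (hf : Primrec f) : Primrec fun a => - f a := by
  refine (primrec_nat_sub_int.comp (primrec_int_neg_toNat.comp hf)
    (primrec_int_toNat.comp hf)).of_eq fun a => ?_
  omega

theorem Primrec.int_mul (hf : Primrec f) (hg : Primrec g) : Primrec fun a => f a * g a := by
  have hf1 := primrec_int_toNat.comp hf
  have hf2 := primrec_int_neg_toNat.comp hf
  have hg1 := primrec_int_toNat.comp hg
  have hg2 := primrec_int_neg_toNat.comp hg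
  refine (primrec_nat_sub_int.comp
    (Primrec.nat_add.comp (Primrec.nat_mul.comp hf1 hg1) (Primrec.nat_mul.comp hf2 hg2))
    (Primrec.nat_add.comp (Primrec.nat_mul.comp hf1 hg2) (Primrec.nat_mul.comp hf2 hg1))).of_eq
    fun a => ?_
  have e : ∀ z : ℤ, z = (z.toNat : ℤ) - ((-z).toNat : ℤ) := fun z => by omega
  conv_rhs => rw [e (f a), e (g a)]
  push_cast
  ring

theorem Primrec.int_natAbs (hf : Primrec f) : Primrec fun a => (f a).natAbs := by
  refine (Primrec.nat_add.comp (primrec_int_toNat.comp hf)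
    (primrec_int_neg_toNat.comp hf)).of_eq fun a => ?_
  omega

end IntPrimrec

section MatrixPrimrec

variable {α : Type*} [Primcodable α] {f g : α → Matrix (Fin 2) (Fin 2) ℤ}

theorem Primrec.matrix_entry (hf : Primrec f) (i j : Fin 2) : Primrec fun a => f a i j := by
  have h : Primrec fun A : Matrix (Fin 2) (Fin 2) ℤ => (Matrix.of.symm A : Fin 2 → Fin 2 → ℤ) :=
    Primrec.of_equiv (e := (Matrix.of.symm : Matrix (Fin 2) (Fin 2) ℤ ≃ (Fin 2 → Fin 2 → ℤ)))
  exact Primrec.fin_app.comp (Primrec.fin_app.comp (h.comp hf) (Primrec.const i)) (Primrec.const j)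

theorem Primrec.matrix_of_entries {F : α → Fin 2 → Fin 2 → ℤ}
    (h : ∀ i j, Primrec fun a => F a i j) : Primrec fun a => Matrix.of (F a) := by
  have h1 : Primrec F := by
    refine Primrec.fin_curry.2 (Primrec.fin_curry₁ (f := fun i a => F a i) |>.2 fun i => ?_).swap
    exact Primrec.fin_curry.2
      (Primrec.fin_curry₁ (f := fun j a => F a i j) |>.2 fun j => h i j).swap
  exact (Primrec.of_equiv_symm
    (e := (Matrix.of.symm : Matrix (Fin 2) (Fin 2) ℤ ≃ (Fin 2 → Fin 2 → ℤ)))).comp h1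

theorem Primrec.matrix_mul (hf : Primrec f) (hg : Primrec g) : Primrec fun a => f a * g a := by
  refine (Primrec.matrix_of_entries (F := fun a i j => f a i 0 * g a 0 j + f a i 1 * g a 1 j)
    fun i j => ?_).of_eq fun a => ?_
  · exact ((hf.matrix_entry i 0).int_mul (hg.matrix_entry 0 j)).int_add
      ((hf.matrix_entry i 1).int_mul (hg.matrix_entry 1 j))
  · ext i j
    simp [mul_apply, Fin.sum_univ_two]

theorem Primrec.matrix_adjugate (hf : Primrec f) : Primrec fun a => (f a).adjugate := by
  refine (Primrec.matrix_of_entries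
    (F := fun a => ![![f a 1 1, - f a 0 1], ![- f a 1 0, f a 0 0]]) fun i j => ?_).of_eq fun a => ?_
  · fin_cases i <;> fin_cases j
    · exact hf.matrix_entry 1 1
    · exact (hf.matrix_entry 0 1).int_neg
    · exact (hf.matrix_entry 1 0).int_neg
    · exact hf.matrix_entry 0 0
  · rw [adjugate_fin_two]

theorem Primrec.matrix_det (hf : Primrec f) : Primrec fun a => (f a).det := by
  refine (((hf.matrix_entry 0 0).int_mul (hf.matrix_entry 1 1)).int_add
    ((hf.matrix_entry 0 1).int_mul (hf.matrix_entry 1 0)).int_neg).of_eq fun a => ?_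
  rw [det_fin_two, sub_eq_add_neg]

theorem Primrec.sqSum (hf : Primrec f) : Primrec fun a => sqSum (f a) :=
  (((hf.matrix_entry 0 0).int_mul (hf.matrix_entry 0 0)).int_add
    ((hf.matrix_entry 0 1).int_mul (hf.matrix_entry 0 1))).int_add
  (((hf.matrix_entry 1 0).int_mul (hf.matrix_entry 1 0)).int_add
    ((hf.matrix_entry 1 1).int_mul (hf.matrix_entry 1 1)))

theorem primrec_matrix_list_prod :
    Primrec (List.prod : List (Matrix (Fin 2) (Fin 2) ℤ) → Matrix (Fin 2) (Fin 2) ℤ) := by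
  refine (Primrec.list_foldr (f := id) (g := fun _ => 1) (h := fun _ p => p.1 * p.2) Primrec.id
    (Primrec.const 1) ?_).of_eq fun l => rfl
  exact Primrec.matrix_mul (Primrec.fst.comp Primrec.snd) (Primrec.snd.comp Primrec.snd)

end MatrixPrimrec

/-! ### Balls in the free subgroup -/

namespace Sanov

/-- A list of the images of the words of length at most `r` in the free generators. -/
def ball (r : ℕ) : List (Matrix (Fin 2) (Fin 2) ℤ) :=
  Nat.rec [1] (fun _ l => l ++ l.flatMap fun U =>
    [(true, true), (true, false), (false, true), (false, false)].map fun x => letter x * U) r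

theorem primrec_ball : Primrec ball := by
  refine Primrec.nat_rec₁ _ ?_
  refine Primrec.list_append.comp Primrec.snd (Primrec.list_flatMap Primrec.snd ?_)
  refine Primrec.list_map (Primrec.const _) ?_
  exact Primrec.matrix_mul ((Primrec.dom_finite letter).comp Primrec.snd)
    (Primrec.snd.comp Primrec.fst)

theorem ball_succ (r : ℕ) : ball (r + 1) = ball r ++ (ball r).flatMap fun U =>
    [(true, true), (true, false), (false, true), (false, false)].map fun x => letter x * U := rfl

theorem mem_ball {r : ℕ} {U : Matrix (Fin 2) (Fin 2) ℤ} :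
    U ∈ ball r ↔ ∃ w : FreeGroup Bool, w.norm ≤ r ∧ hom w = U := by
  have hlist : U ∈ ball r ↔ ∃ L : List (Bool × Bool), L.length ≤ r ∧ hom (FreeGroup.mk L) = U := by
    induction r generalizing U with
    | zero =>
      simp [ball, ← FreeGroup.one_eq_mk, eq_comm]
    | succ r ih =>
      rw [ball_succ, List.mem_append, List.mem_flatMap]
      constructor
      · rintro (h | ⟨V, hV, h⟩)
        · obtain ⟨L, hL, e⟩ := ih.1 h
          exact ⟨L, by omega, e⟩
        · obtain ⟨L, hL, rfl⟩ := ih.1 hV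
          obtain ⟨x, -, rfl⟩ := List.mem_map.1 h
          exact ⟨x :: L, by simpa using hL, hom_mk_cons x L⟩
      · rintro ⟨L, hL, rfl⟩
        rcases L with _ | ⟨x, L⟩
        · exact Or.inl (ih.2 ⟨[], by simp, rfl⟩)
        · refine Or.inr ⟨_, ih.2 ⟨L, by simpa using hL, rfl⟩, List.mem_map.2 ⟨x, ?_, ?_⟩⟩
          · rcases x with ⟨_ | _, _ | _⟩ <;> simp
          · exact (hom_mk_cons x L).symm
  rw [hlist]
  constructor
  · rintro ⟨L, hL, e⟩
    exact ⟨_, FreeGroup.norm_mk_le.trans hL, e⟩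
  · rintro ⟨w, hw, e⟩
    exact ⟨w.toWord, hw, by rw [FreeGroup.mk_toWord, e]⟩

end Sanov

/-! ### Finitely many orbits of bounded determinant -/

/-- Nonsingular matrices of the same determinant `d` that are congruent modulo `4 * d` lie in one
orbit of Sanov's group. -/
theorem Sanov.exists_hom_mul_eq {X Y : Matrix (Fin 2) (Fin 2) ℤ} (hdet : X.det = Y.det)
    (hY : Y.det ≠ 0) (h : ∀ i j, 4 * Y.det ∣ X i j - Y i j) : ∃ w, hom w * Y = X := by
  choose Z hZ using h
  have hX : X = Y + (4 * Y.det) • Matrix.of Z := by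
    ext i j
    have := hZ i j
    simp only [Matrix.add_apply, Matrix.smul_apply, of_apply, smul_eq_mul]
    linarith
  -- `X * Y⁻¹` is an integer matrix, because `X * Y.adjugate` is divisible by `Y.det`.
  set W : Matrix (Fin 2) (Fin 2) ℤ := Matrix.of Z * Y.adjugate with hW
  have hU : (1 + (4 : ℤ) • W) * Y = X := by
    rw [add_mul, one_mul, hX, hW, smul_mul_assoc, mul_assoc, adjugate_mul, Matrix.mul_smul, mul_one,
      smul_smul]
  have hU1 : (1 + (4 : ℤ) • W).det = 1 := by
    have := congrArg det hU
    rw [det_mul, hdet] at this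
    exact (mul_eq_right₀ hY).1 this
  have hij : ∀ i j, (1 + (4 : ℤ) • W) i j = (1 : Matrix (Fin 2) (Fin 2) ℤ) i j + 4 * W i j :=
    fun i j => by rw [Matrix.add_apply, Matrix.smul_apply, smul_eq_mul]
  obtain ⟨w, hw⟩ := exists_hom_eq (1 + (4 : ℤ) • W) hU1
    (by rw [hij]; simp [Int.ModEq]) (by rw [hij]; simp [Int.ModEq])
    (by rw [hij]; simp [Int.ModEq]; omega) (by rw [hij]; simp [Int.ModEq]; omega)
  exact ⟨w, by rw [hw, hU]⟩

/-- Sanov's group acts by left multiplication on the integer matrices with nonzero determinant of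
absolute value at most `D`. It has only finitely many orbits there: the determinant of a matrix and
its residue modulo `4 * D!` determine the orbit. -/
theorem Sanov.exists_orbit_representatives (D : ℕ) :
    ∃ H : List (Matrix (Fin 2) (Fin 2) ℤ), 1 ∈ H ∧ (∀ h ∈ H, h.det ≠ 0) ∧
      ∀ X : Matrix (Fin 2) (Fin 2) ℤ, X.det ≠ 0 → X.det.natAbs ≤ D →
        ∃ h ∈ H, ∃ w, hom w * h = X := by
  classical
  have hN : NeZero (4 * D.factorial) := ⟨by positivity⟩
  let c : Matrix (Fin 2) (Fin 2) ℤ → ℤ × Matrix (Fin 2) (Fin 2) (ZMod (4 * D.factorial)) :=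
    fun X => (X.det, X.map (Int.cast : ℤ → ZMod (4 * D.factorial)))
  let S : Set (Matrix (Fin 2) (Fin 2) ℤ) := {X | X.det ≠ 0 ∧ X.det.natAbs ≤ D}
  have hfin : (c '' S).Finite := by
    refine ((Set.finite_Icc (-(D : ℤ)) D).prod (Set.toFinite Set.univ)).subset ?_
    rintro _ ⟨X, hX, rfl⟩
    have := hX.2
    exact ⟨⟨by simp only [c]; omega, by simp only [c]; omega⟩, trivial⟩
  obtain ⟨T, hTS, hT⟩ := (Finset.subset_set_image_iff (t := hfin.toFinset) (s := S) (f := c)).1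
    (by simp)
  refine ⟨1 :: T.toList, by simp, ?_, ?_⟩
  · intro h hh
    rcases List.mem_cons.1 hh with rfl | hh
    · simp
    · exact (hTS (Finset.mem_toList.1 hh)).1
  · intro X hX0 hXD
    have hXc : c X ∈ T.image c := by
      rw [hT, Set.Finite.mem_toFinset]
      exact ⟨X, ⟨hX0, hXD⟩, rfl⟩
    obtain ⟨h, hhT, hc⟩ := Finset.mem_image.1 hXc
    have hdet : h.det = X.det := congrArg Prod.fst hc
    have hmod : h.map (Int.cast : ℤ → ZMod (4 * D.factorial)) = X.map Int.cast :=
      congrArg Prod.snd hc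
    refine ⟨h, by simp [hhT], exists_hom_mul_eq hdet.symm (hdet ▸ hX0) fun i j => ?_⟩
    have h1 : ((h i j : ℤ) : ZMod (4 * D.factorial)) = (X i j : ℤ) := congrFun (congrFun hmod i) j
    have h2 := (ZMod.intCast_eq_intCast_iff_dvd_sub _ _ _).1 h1
    refine dvd_trans ?_ h2
    push_cast
    refine mul_dvd_mul_left 4 ?_
    rw [hdet, ← Int.natAbs_dvd]
    exact_mod_cast Nat.dvd_factorial (Int.natAbs_pos.2 hX0) hXD

/-! ### Certificates of non-membership -/

/-- A certificate that the nonsingular matrix `M` is not a product of matrices from `F`. Here `H` is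
a list of representatives of orbits of Sanov's group, a triple `(h, U, h')` in `K` stands for the
claim that `h⁻¹ * U * h'` is a product of matrices from `F`, and `r` bounds the word length of the
group elements `U` that are considered. The list `K` has to contain the claims given by the empty
product and by the single factors (as far as the determinant of `M` admits them), and the composite
of any two of its claims unless that composite is too long, but not the claim that `M` is a product.
The bound on `sqSum` makes `r` large enough for this last claim to be considered. -/
def IsCertificate (F : List (Matrix (Fin 2) (Fin 2) ℤ)) (M : Matrix (Fin 2) (Fin 2) ℤ) (r : ℕ)
    (H : List (Matrix (Fin 2) (Fin 2) ℤ))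
    (K : List (Matrix (Fin 2) (Fin 2) ℤ × Matrix (Fin 2) (Fin 2) ℤ × Matrix (Fin 2) (Fin 2) ℤ)) :
    Prop :=
  1 ∈ H ∧
  (∀ h ∈ H, (h, 1, h) ∈ K) ∧
  (∀ k ∈ K, k.2.1 ∈ Sanov.ball r) ∧
  (∀ h ∈ H, ∀ A ∈ F, M.det.natAbs < (h * A).det.natAbs ∨
    ∃ k ∈ K, k.1 = h ∧ k.2.2 ∈ H ∧ k.2.1 * k.2.2 = h * A) ∧
  (∀ k ∈ K, ∀ l ∈ K, k.2.2 = l.1 → k.2.1 * l.2.1 ∈ Sanov.ball r →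
    (k.1, k.2.1 * l.2.1, l.2.2) ∈ K) ∧
  (∀ h ∈ H, (sqSum (M * h.adjugate)).natAbs ≤ r) ∧
  ∀ k ∈ K, k.1 = 1 → k.2.1 * k.2.2 ≠ M

theorem sqSum_smul (d : ℤ) (U : Matrix (Fin 2) (Fin 2) ℤ) : sqSum (d • U) = d * d * sqSum U := by
  simp only [sqSum, Matrix.smul_apply, smul_eq_mul]
  ring

/-- If `M = hom u * h` with `h` nonsingular, then the length of `u` is bounded in terms of `M` and
`h`. -/
theorem Sanov.norm_le_of_hom_mul_eq {u : FreeGroup Bool} {h M : Matrix (Fin 2) (Fin 2) ℤ}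
    (hh : h.det ≠ 0) (e : hom u * h = M) : u.norm ≤ (sqSum (M * h.adjugate)).natAbs := by
  have h1 : M * h.adjugate = h.det • hom u := by
    rw [← e, mul_assoc, mul_adjugate, Matrix.mul_smul, mul_one]
  have h2 := norm_le_sqSum u
  have h3 : 1 ≤ h.det * h.det := Int.add_one_le_iff.2 (mul_self_pos.2 hh)
  rw [h1, sqSum_smul]
  have h4 : sqSum (hom u) ≤ h.det * h.det * sqSum (hom u) :=
    le_mul_of_one_le_left (by omega) h3
  omega

/-- The partial products of `M = A₁ ⋯ Aₙ` are written as `hom uᵢ * hᵢ` with `hᵢ ∈ H`. Passing from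
one to the next is a claim in `K`, so the passage from the first to the last is one too, by the
tree-like geometry of the free group. -/
theorem IsCertificate.not_mem_closure {F : List (Matrix (Fin 2) (Fin 2) ℤ)}
    {M : Matrix (Fin 2) (Fin 2) ℤ} {r : ℕ} {H : List (Matrix (Fin 2) (Fin 2) ℤ)}
    {K : List (Matrix (Fin 2) (Fin 2) ℤ × Matrix (Fin 2) (Fin 2) ℤ × Matrix (Fin 2) (Fin 2) ℤ)}
    (hF : ∀ A ∈ F, A.det ≠ 0) (hM : M.det ≠ 0) (hcert : IsCertificate F M r H K) :
    M ∉ Submonoid.closure {A | A ∈ F} := by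
  intro hmem
  obtain ⟨h1H, hrefl, hball, hgen, hcomp, hsize, hnot⟩ := hcert
  let Q : FreeGroup Bool × Matrix (Fin 2) (Fin 2) ℤ → FreeGroup Bool × Matrix (Fin 2) (Fin 2) ℤ →
    Prop := fun x y => (x.2, Sanov.hom (x.1⁻¹ * y.1), y.2) ∈ K
  have hreach : ∀ l : List (Matrix (Fin 2) (Fin 2) ℤ), (∀ A ∈ l, A ∈ F) →
      l.prod.det.natAbs ≤ M.det.natAbs → ∃ u, ∃ h ∈ H, Sanov.hom u * h = l.prod ∧
        Relation.ReflTransGen Q (1, 1) (u, h) := by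
    intro l
    induction l using List.reverseRecOn with
    | nil => exact fun _ _ => ⟨1, 1, h1H, by simp, .refl⟩
    | append_singleton l A ih =>
      intro hl hdet
      have hA : A ∈ F := hl A (by simp)
      rw [List.prod_append, List.prod_singleton] at hdet ⊢
      have hle : l.prod.det.natAbs ≤ (l.prod * A).det.natAbs := by
        rw [det_mul, Int.natAbs_mul]
        exact Nat.le_mul_of_pos_right _ (Int.natAbs_pos.2 (hF A hA))
      obtain ⟨u, h, hhH, e, hu⟩ := ih (fun B hB => hl B (by simp [hB])) (hle.trans hdet)
      have e2 : (h * A).det = (l.prod * A).det := by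
        rw [← e, det_mul, det_mul, det_mul, Sanov.det_hom, one_mul]
      rcases hgen h hhH A hA with hlt | ⟨⟨h₁, U, h'⟩, hk, rfl, hh', e3⟩
      · rw [e2] at hlt; omega
      obtain ⟨v, -, rfl⟩ := Sanov.mem_ball.1 (hball _ hk)
      refine ⟨u * v, h', hh', ?_, hu.tail ?_⟩
      · rw [map_mul, mul_assoc, ← e, mul_assoc]
        exact congrArg _ e3
      · simpa only [Q, inv_mul_cancel_left] using hk
  obtain ⟨l, hl, rfl⟩ := Submonoid.exists_list_of_mem_closure hmem
  obtain ⟨u, h, hh, e, hu⟩ := hreach l hl le_rfl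
  have hdet : h.det ≠ 0 := by
    intro h0
    rw [← e, det_mul, h0, mul_zero] at hM
    exact hM rfl
  have hur : u.norm ≤ r := (Sanov.norm_le_of_hom_mul_eq hdet e).trans (hsize h hh)
  have hQ : Q (1, 1) (u, h) := by
    refine rel_of_reflTransGen_of_dist_le (d := fun x y => (x.1⁻¹ * y.1).norm) (r := r)
      (fun x w y z => FreeGroup.four_point x.1 w.1 y.1 z.1) (fun x => by simp) ?_ ?_ ?_ hu ?_
    · intro x y hxy
      obtain ⟨v, hv, e⟩ := Sanov.mem_ball.1 (hball _ hxy)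
      rwa [← Sanov.hom_injective e]
    · intro x y z hxy hyz hd
      have e3 : Sanov.hom (x.1⁻¹ * y.1) * Sanov.hom (y.1⁻¹ * z.1) = Sanov.hom (x.1⁻¹ * z.1) := by
        rw [← map_mul]
        congr 1
        group
      have := hcomp _ hxy _ hyz rfl
      simp only [e3] at this
      exact this (Sanov.mem_ball.2 ⟨_, hd, rfl⟩)
    · simpa [Q] using hrefl 1 h1H
    · simpa using hur
  refine hnot _ hQ rfl ?_
  simpa using e

/-- If `M` is not a product of matrices from `F`, then the true claims about the finitely many
triples `(h, U, h')` under consideration form a certificate. -/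
theorem exists_isCertificate {F : List (Matrix (Fin 2) (Fin 2) ℤ)} {M : Matrix (Fin 2) (Fin 2) ℤ}
    (hF : ∀ A ∈ F, A.det ≠ 0) (hnot : M ∉ Submonoid.closure {A | A ∈ F}) :
    ∃ r H K, IsCertificate F M r H K := by
  obtain ⟨H, h1H, hH0, hrep⟩ := Sanov.exists_orbit_representatives M.det.natAbs
  have hr : ∀ᶠ r : ℕ in Filter.atTop,
      (∀ h ∈ {h | h ∈ H}, ∀ A ∈ {A | A ∈ F}, M.det.natAbs < (h * A).det.natAbs ∨
        ∃ h' ∈ H, ∃ w : FreeGroup Bool, w.norm ≤ r ∧ Sanov.hom w * h' = h * A) ∧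
      ∀ h ∈ {h | h ∈ H}, (sqSum (M * h.adjugate)).natAbs ≤ r := by
    refine Filter.Eventually.and ?_ ?_
    · refine (Filter.eventually_all_finite (List.finite_toSet H)).2 fun h hh => ?_
      refine (Filter.eventually_all_finite (List.finite_toSet F)).2 fun A hA => ?_
      by_cases hlt : M.det.natAbs < (h * A).det.natAbs
      · exact Filter.Eventually.of_forall fun _ => Or.inl hlt
      · obtain ⟨h', hh', w, e⟩ := hrep (h * A)
          (by rw [det_mul]; exact mul_ne_zero (hH0 h hh) (hF A hA)) (by omega)
        filter_upwards [Filter.eventually_ge_atTop w.norm] with r hr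
        exact Or.inr ⟨h', hh', w, hr, e⟩
    · refine (Filter.eventually_all_finite (List.finite_toSet H)).2 fun h hh => ?_
      exact Filter.eventually_ge_atTop _
  obtain ⟨r, hgen, hsize⟩ := hr.exists
  have hfin : {k : Matrix (Fin 2) (Fin 2) ℤ × Matrix (Fin 2) (Fin 2) ℤ × Matrix (Fin 2) (Fin 2) ℤ |
      (k.1 ∈ H ∧ k.2.1 ∈ Sanov.ball r ∧ k.2.2 ∈ H) ∧
        ∃ C ∈ Submonoid.closure {A | A ∈ F}, k.2.1 * k.2.2 = k.1 * C}.Finite :=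
    ((List.finite_toSet H).prod ((List.finite_toSet (Sanov.ball r)).prod
      (List.finite_toSet H))).subset fun k hk => hk.1
  have h1ball : (1 : Matrix (Fin 2) (Fin 2) ℤ) ∈ Sanov.ball r :=
    Sanov.mem_ball.2 ⟨1, by simp, map_one _⟩
  refine ⟨r, H, hfin.toFinset.toList, h1H, ?_, ?_, ?_, ?_, hsize, ?_⟩ <;>
    simp only [Finset.mem_toList, Set.Finite.mem_toFinset, Set.mem_ofPred_eq]
  · exact fun h hh => ⟨⟨hh, h1ball, hh⟩, 1, one_mem _, by simp⟩
  · exact fun k hk => hk.1.2.1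
  · intro h hh A hA
    rcases hgen h hh A hA with hlt | ⟨h', hh', w, hw, e⟩
    · exact Or.inl hlt
    · exact Or.inr ⟨(h, Sanov.hom w, h'), ⟨⟨hh, Sanov.mem_ball.2 ⟨w, hw, rfl⟩, hh'⟩, A,
        Submonoid.subset_closure hA, e⟩, rfl, hh', e⟩
  · rintro k ⟨hk, C, hC, e⟩ l ⟨hl, C', hC', e'⟩ hkl hUV
    refine ⟨⟨hk.1, hUV, hl.2.2⟩, C * C', mul_mem hC hC', ?_⟩
    rw [mul_assoc, e', ← hkl, ← mul_assoc, e, mul_assoc]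
  · rintro k ⟨-, C, hC, e⟩ hk1 rfl
    rw [hk1, one_mul] at e
    exact hnot (e ▸ hC)

/-! ### Recursively enumerable predicates -/

section Enumerable

variable {α β : Type*} [Primcodable α] [Primcodable β]

theorem PrimrecPred.forall_mem_list_apply {f : α → List β} {p : α → β → Prop} (hf : Primrec f)
    (hp : PrimrecPred fun x : α × β => p x.1 x.2) : PrimrecPred fun a => ∀ b ∈ f a, p a b := by
  have hR : PrimrecRel fun (b : β) (a : α) => p a b :=
    hp.comp (Primrec.pair Primrec.snd Primrec.fst)
  exact hR.forall_mem_list.comp hf Primrec.id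

theorem PrimrecPred.exists_mem_list_apply {f : α → List β} {p : α → β → Prop} (hf : Primrec f)
    (hp : PrimrecPred fun x : α × β => p x.1 x.2) : PrimrecPred fun a => ∃ b ∈ f a, p a b := by
  have hR : PrimrecRel fun (b : β) (a : α) => p a b :=
    hp.comp (Primrec.pair Primrec.snd Primrec.fst)
  exact hR.exists_mem_list.comp hf Primrec.id

theorem PrimrecPred.mem_list {f : α → List β} {g : α → β} (hg : Primrec g) (hf : Primrec f) :
    PrimrecPred fun a => g a ∈ f a :=
  (PrimrecPred.exists_mem_list_apply (p := fun a b => b = g a) hf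
    (Primrec.eq.comp Primrec.snd (hg.comp Primrec.fst))).of_eq fun a => by simp

theorem PrimrecPred.imp {p q : α → Prop} (hp : PrimrecPred p) (hq : PrimrecPred q) :
    PrimrecPred fun a => p a → q a := by
  classical
  exact (hp.not.or hq).of_eq fun a => by tauto

/-- An existential quantifier over certificates of a primitive recursive predicate gives
a recursively enumerable predicate. -/
theorem PrimrecPred.rePred_exists {p : α × β → Prop} (hp : PrimrecPred p) :
    REPred fun a => ∃ b, p (a, b) := by
  classical
  have h : Primrec₂ fun (a : α) (n : ℕ) =>
      (Encodable.decode (α := β) n).bind fun b => if p (a, b) then some () else none := by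
    refine Primrec.option_bind (Primrec.decode.comp Primrec.snd) ?_
    exact Primrec.ite (hp.comp (Primrec.pair (Primrec.fst.comp Primrec.fst) Primrec.snd))
      (Primrec.const _) (Primrec.const _)
  refine (Partrec.rfindOpt h.to_comp).dom_re.of_eq fun a => ?_
  rw [Nat.rfindOpt_dom]
  constructor
  · rintro ⟨n, x, hx⟩
    simp only [Option.mem_def, Option.bind_eq_some_iff] at hx
    obtain ⟨b, -, hb⟩ := hx
    by_cases hpb : p (a, b)
    · exact ⟨b, hpb⟩
    · simp [hpb] at hb
  · rintro ⟨b, hb⟩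
    exact ⟨Encodable.encode b, (), by simp [hb]⟩

end Enumerable

/-! ### The decision procedure -/

theorem primrecPred_isCertificate : PrimrecPred fun x :
    (List (Matrix (Fin 2) (Fin 2) ℤ) × Matrix (Fin 2) (Fin 2) ℤ) ×
      (ℕ × List (Matrix (Fin 2) (Fin 2) ℤ) ×
        List (Matrix (Fin 2) (Fin 2) ℤ × Matrix (Fin 2) (Fin 2) ℤ × Matrix (Fin 2) (Fin 2) ℤ)) =>
    IsCertificate x.1.1 x.1.2 x.2.1 x.2.2.1 x.2.2.2 := by
  have f : ∀ {α β : Type} [Primcodable α] [Primcodable β], Primrec (@Prod.fst α β) := Primrec.fst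
  have s : ∀ {α β : Type} [Primcodable α] [Primcodable β], Primrec (@Prod.snd α β) := Primrec.snd
  refine PrimrecPred.and ?_ (.and ?_ (.and ?_ (.and ?_ (.and ?_ (.and ?_ ?_)))))
  · exact .mem_list (.const 1) (f.comp (s.comp s))
  · refine .forall_mem_list_apply (f.comp (s.comp s)) ?_
    exact .mem_list (s.pair ((Primrec.const 1).pair s)) (s.comp (s.comp (s.comp f)))
  · refine .forall_mem_list_apply (s.comp (s.comp s)) ?_
    exact .mem_list (f.comp (s.comp s)) (Sanov.primrec_ball.comp (f.comp (s.comp f)))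
  · refine .forall_mem_list_apply (f.comp (s.comp s)) ?_
    refine .forall_mem_list_apply (f.comp (f.comp f)) ?_
    have hA := Primrec.matrix_mul (s.comp f) s
      (α := (((List (Matrix (Fin 2) (Fin 2) ℤ) × Matrix (Fin 2) (Fin 2) ℤ) ×
      (ℕ × List (Matrix (Fin 2) (Fin 2) ℤ) × List (Matrix (Fin 2) (Fin 2) ℤ ×
        Matrix (Fin 2) (Fin 2) ℤ × Matrix (Fin 2) (Fin 2) ℤ))) × Matrix (Fin 2) (Fin 2) ℤ) ×
        Matrix (Fin 2) (Fin 2) ℤ)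
    refine .or (Primrec.nat_lt.comp (s.comp (f.comp (f.comp f))).matrix_det.int_natAbs
      hA.matrix_det.int_natAbs) ?_
    refine .exists_mem_list_apply (s.comp (s.comp (s.comp (f.comp f)))) ?_
    refine .and (Primrec.eq.comp (f.comp s) (s.comp (f.comp f))) (.and ?_ ?_)
    · exact .mem_list (s.comp (s.comp s)) (f.comp (s.comp (s.comp (f.comp (f.comp f)))))
    · exact Primrec.eq.comp ((f.comp (s.comp s)).matrix_mul (s.comp (s.comp s))) (hA.comp f)
  · refine .forall_mem_list_apply (s.comp (s.comp s)) ?_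
    refine .forall_mem_list_apply (s.comp (s.comp (s.comp f))) ?_
    refine .imp (Primrec.eq.comp (s.comp (s.comp (s.comp f))) (f.comp s)) ?_
    have hUV := (f.comp (s.comp (s.comp f))).matrix_mul (f.comp (s.comp s))
      (α := (((List (Matrix (Fin 2) (Fin 2) ℤ) × Matrix (Fin 2) (Fin 2) ℤ) ×
      (ℕ × List (Matrix (Fin 2) (Fin 2) ℤ) × List (Matrix (Fin 2) (Fin 2) ℤ ×
        Matrix (Fin 2) (Fin 2) ℤ × Matrix (Fin 2) (Fin 2) ℤ))) × (Matrix (Fin 2) (Fin 2) ℤ ×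
        Matrix (Fin 2) (Fin 2) ℤ × Matrix (Fin 2) (Fin 2) ℤ)) × (Matrix (Fin 2) (Fin 2) ℤ ×
        Matrix (Fin 2) (Fin 2) ℤ × Matrix (Fin 2) (Fin 2) ℤ))
    refine .imp (.mem_list hUV (Sanov.primrec_ball.comp (f.comp (s.comp (f.comp f))))) ?_
    exact .mem_list ((f.comp (s.comp f)).pair (hUV.pair (s.comp (s.comp s))))
      (s.comp (s.comp (s.comp (f.comp f))))
  · refine .forall_mem_list_apply (f.comp (s.comp s)) ?_
    exact Primrec.nat_le.comp (((s.comp (f.comp f)).matrix_mul s.matrix_adjugate).sqSum.int_natAbs)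
      (f.comp (s.comp f))
  · refine .forall_mem_list_apply (s.comp (s.comp s)) ?_
    refine .imp (Primrec.eq.comp (f.comp s) (.const 1)) (.not ?_)
    exact Primrec.eq.comp ((f.comp (s.comp s)).matrix_mul (s.comp (s.comp s)))
      (s.comp (f.comp f))

theorem rePred_mem_closure : REPred fun x :
    List (Matrix (Fin 2) (Fin 2) ℤ) × Matrix (Fin 2) (Fin 2) ℤ =>
    (∀ A ∈ x.1, A.det ≠ 0) ∧ x.2 ∈ Submonoid.closure {A | A ∈ x.1} := by
  have h : PrimrecPred fun y : (List (Matrix (Fin 2) (Fin 2) ℤ) × Matrix (Fin 2) (Fin 2) ℤ) ×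
      List (Matrix (Fin 2) (Fin 2) ℤ) => (∀ A ∈ y.1.1, A.det ≠ 0) ∧
        (∀ A ∈ y.2, A ∈ y.1.1) ∧ y.2.prod = y.1.2 := by
    refine .and ?_ (.and ?_ ?_)
    · exact .forall_mem_list_apply (Primrec.fst.comp Primrec.fst)
        (PrimrecPred.not (Primrec.eq.comp Primrec.snd.matrix_det (.const 0)))
    · exact .forall_mem_list_apply Primrec.snd
        (.mem_list Primrec.snd (Primrec.fst.comp (Primrec.fst.comp Primrec.fst)))
    · exact Primrec.eq.comp (primrec_matrix_list_prod.comp Primrec.snd)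
        (Primrec.snd.comp Primrec.fst)
  refine h.rePred_exists.of_eq fun x => ?_
  constructor
  · rintro ⟨l, h0, hl, e⟩
    exact ⟨h0, e ▸ Submonoid.list_prod_mem _ fun A hA => Submonoid.subset_closure (hl A hA)⟩
  · rintro ⟨h0, hx⟩
    obtain ⟨l, hl, e⟩ := Submonoid.exists_list_of_mem_closure hx
    exact ⟨l, h0, hl, e⟩

/-- Non-membership is recursively enumerable: a matrix of determinant zero is never a product of
nonsingular ones, and for the other matrices one searches for a certificate. -/
theorem rePred_not_mem_closure : REPred fun x :
    List (Matrix (Fin 2) (Fin 2) ℤ) × Matrix (Fin 2) (Fin 2) ℤ =>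
    ¬ ((∀ A ∈ x.1, A.det ≠ 0) ∧ x.2 ∈ Submonoid.closure {A | A ∈ x.1}) := by
  have h1 : PrimrecPred fun y : (List (Matrix (Fin 2) (Fin 2) ℤ) × Matrix (Fin 2) (Fin 2) ℤ) ×
      (ℕ × List (Matrix (Fin 2) (Fin 2) ℤ) ×
        List (Matrix (Fin 2) (Fin 2) ℤ × Matrix (Fin 2) (Fin 2) ℤ × Matrix (Fin 2) (Fin 2) ℤ)) =>
      ∃ A ∈ y.1.1, A.det = 0 :=
    .exists_mem_list_apply (Primrec.fst.comp Primrec.fst)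
      (Primrec.eq.comp Primrec.snd.matrix_det (.const 0))
  have h2 : PrimrecPred fun y : (List (Matrix (Fin 2) (Fin 2) ℤ) × Matrix (Fin 2) (Fin 2) ℤ) ×
      (ℕ × List (Matrix (Fin 2) (Fin 2) ℤ) ×
        List (Matrix (Fin 2) (Fin 2) ℤ × Matrix (Fin 2) (Fin 2) ℤ × Matrix (Fin 2) (Fin 2) ℤ)) =>
      y.1.2.det = 0 :=
    Primrec.eq.comp (Primrec.snd.comp Primrec.fst).matrix_det (.const 0)
  refine (h1.or (h2.or primrecPred_isCertificate)).rePred_exists.of_eq fun ⟨F, M⟩ => ?_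
  simp only
  constructor
  · rintro ⟨⟨r, H, K⟩, ⟨A, hA, h0⟩ | h⟩ ⟨hF, hmem⟩
    · exact hF A hA h0
    have hM : M.det ≠ 0 := by
      have hle : Submonoid.closure {A | A ∈ F} ≤
          (nonZeroDivisors ℤ).comap (Matrix.detMonoidHom : Matrix (Fin 2) (Fin 2) ℤ →* ℤ) :=
        Submonoid.closure_le.2 fun A hA => mem_nonZeroDivisors_of_ne_zero (hF A hA)
      exact nonZeroDivisors.ne_zero (hle hmem)
    rcases h with h | h
    · exact hM h
    · exact h.not_mem_closure hF hM hmem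
  · intro h
    by_cases hF : ∀ A ∈ F, A.det ≠ 0
    · obtain ⟨r, H, K, hc⟩ := exists_isCertificate hF fun hmem => h ⟨hF, hmem⟩
      exact ⟨(r, H, K), Or.inr (Or.inr hc)⟩
    · push Not at hF
      exact ⟨(0, [], []), Or.inl hF⟩

theorem theorem1 :
    ∃ f : List (Matrix (Fin 2) (Fin 2) ℤ) × Matrix (Fin 2) (Fin 2) ℤ → Bool,
      Computable f ∧
        ∀ (F : List (Matrix (Fin 2) (Fin 2) ℤ)) (M : Matrix (Fin 2) (Fin 2) ℤ),
          (∀ A ∈ F, A.det ≠ 0) →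
            (f (F, M) = true ↔ M ∈ Submonoid.closure {A | A ∈ F}) := by
  obtain ⟨f, hf, e⟩ := ComputablePred.computable_iff.1
    (ComputablePred.computable_iff_re_compl_re'.2 ⟨rePred_mem_closure, rePred_not_mem_closure⟩)
  refine ⟨f, hf, fun F M hF => ?_⟩
  have h := congrFun e (F, M)
  exact ⟨fun ht => (h.mpr ht).2, fun hm => h.mp ⟨hF, hm⟩⟩
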